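/- **Theorem.** There is an absolute constant $K>0$ such that the following holds for every $k\ge 0$, every set $V$, every function $f:\{0,1\}^{2^k}\to V$ and every ordering of its $2^k$ variables. Let $B$ be the BDD and let $C$ be the level-$k$ CFLOBDD for $f$, both with this variable ordering. Then the number $|G(C)|$ of groupings of $C$ satisfies $$|G(C)|\;\le\; K\,|B|\log |B| ,$$ that is, $|G(C)|=\mathcal O(|B|\log|B|)$, whether the size $|B|$ is the number of nodes of $B$ (terminal nodes included) or the number of its edges. Here a *BDD* is a quasi-reduced multi-terminal ordered binary decision diagram: a finite rooted directed acyclic graph that reads the variables one by one in the given order without skipping any, whose nodes are all reachable from the root, in which two different non-terminal nodes of equal depth never have the same pair (false-successor, true-successor), and in which different terminal nodes carry different values in $V$. The interpretation of an assignment is the value of the terminal node it leads to. A *mock-CFLOBDD* at level $k$ consists of finitely many groupings at levels $0,\dots,k$: one at level $k$ (the head), and every other grouping is called by some grouping one level up. A grouping has an entry vertex and an ordered list of exit vertices. At level $0$ it is a *don't-care grouping* (one exit, to which both branches lead) or a *fork grouping* (two exits, the branch for $0$ leading to the first and the branch for $1$ to the second). A grouping $g$ at level $l\ge 1$ also has an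 ordered list of middle vertices, an A-call from its entry vertex to a level-$(l-1)$ grouping with return edges from each exit of the callee to a middle vertex of $g$, and, for each middle vertex, a B-call to a level-$(l-1)$ grouping with return edges from each exit of the callee to an exit of $g$. Each exit of the head carries a value in $V$. An assignment is interpreted along a matched path: through a level-$l$ grouping, $l\ge1$, the first $2^{l-1}$ of its $2^l$ variables are read in the A-callee, the path returns along the matching A-return edge to a middle vertex $m$, the other $2^{l-1}$ variables are read in the B-callee of $m$, and the path returns along the matching B-return edge; a level-$0$ grouping reads one variable. The value at the exit of the head that is reached is the result. The *return tuple* of a call lists the targets of its return edges, in the order of the exits of the callee. Two groupings are *equal* if they head isomorphic hierarchical structures (same numbers of vertices, equal callees, same return tuples; the same kind at level $0$). A *CFLOBDD* is a mock-CFLOBDD such that 1. the return tuple of every A-call is $[1,2,\dots,r]$, where $r$ is both the number of exits of the callee and the number of middle vertices of the caller; 2. (a) the return tuple of every B-call has no repetitions; (b) if $n$ is the largest index that occurs in the return tuples of the B-calls of the earlier middle vertices of the same grouping ($n=0$ if there are none), then the subsequence of its entries greater than $n$ is $[n+1,\dots,n+m]$ for some $m\ge0$; and every exit of a grouping at level $\ge1$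 is the target of some B-return edge; 3. no two different groupings are equal; 4. two different B-calls of the same grouping that lead to equal groupings have different return tuples; 5. different exits of the head carry different values. -/

import Mathlib

universe u

/-- A quasi-reduced multi-terminal ordered binary decision diagram that reads `n` Boolean
variables (`BDD` for short): a finite rooted acyclic graph, stored ply by ply.  Plies are never
skipped, so the depth of a node (its distance from the root) is the number of variables read. -/
structure BDD (V : Type u) (n : ℕ) where
  /-- the nodes at depth `d` -/
  Node : ℕ → Type
  finite_nodes : Finite (Σ d, Node d)
  no_node_below : ∀ d, n < d → IsEmpty (Node d)
  root : Node 0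
  /-- the `false`-successor and the `true`-successor of a non-terminal node -/
  succ : ∀ {d : ℕ}, d < n → Node d → Bool → Node (d + 1)
  /-- the value of a terminal node -/
  value : Node n → V
  /-- the root is the only node at depth `0` -/
  root_unique : ∀ u : Node 0, u = root
  /-- every other node has a predecessor, so every node is reachable from the root -/
  reachable : ∀ {d : ℕ} (hd : d < n) (v : Node (d + 1)), ∃ (u : Node d) (b : Bool), succ hd u b = v
  /-- maximal sharing: no two non-terminal nodes have the same pair of successors -/
  node_shared : ∀ {d : ℕ} (hd : d < n) (u v : Node d), (∀ b, succ hd u b = succ hd v b) → u = v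
  /-- maximal sharing: no two terminal nodes have the same value -/
  value_shared : Function.Injective value

namespace BDD

variable {V : Type u} {n : ℕ}

/-- The node reached from the root after the first `d` variables have been interpreted; `a i` is
the Boolean that is read in step `i`. -/
def nodeAfter (B : BDD V n) (a : Fin n → Bool) : (d : ℕ) → d ≤ n → B.Node d
  | 0, _ => B.root
  | d + 1, h => B.succ h (B.nodeAfter a d (Nat.le_of_succ_le h)) (a ⟨d, h⟩)

/-- The interpretation of an assignment, given as the sequence of Booleans in reading order. -/
def eval (B : BDD V n) (a : Fin n → Bool) : V :=
  B.value (B.nodeAfter a n le_rfl)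

/-- `B` represents `f` with the variable ordering `ord`: the variable read in step `i` is
the variable number `ord i` of `f`. -/
def Represents (B : BDD V n) (ord : Equiv.Perm (Fin n)) (f : (Fin n → Bool) → V) : Prop :=
  ∀ x : Fin n → Bool, B.eval (fun i => x (ord i)) = f x

/-- The number of nodes (terminal and non-terminal). -/
noncomputable def numNodes (B : BDD V n) : ℕ :=
  Nat.card (Σ d, B.Node d)

/-- The number of edges: an edge is given by its source, a non-terminal node, and its label. -/
noncomputable def numEdges (B : BDD V n) : ℕ :=
  Nat.card ({u : Σ d, B.Node d // u.1 < n} × Bool)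

end BDD

/-- A mock-CFLOBDD at level `k`.  The exit vertices of a grouping `g` are `Fin (numExits g)`, its
middle vertices (if its level is at least `1`) are `Fin (numMids g)`, in their fixed order; the
entry vertex of `g` is not named separately. -/
structure MockCFLOBDD (V : Type u) (k : ℕ) where
  /-- the groupings at level `l` -/
  Grouping : ℕ → Type
  finite_groupings : Finite (Σ l, Grouping l)
  no_grouping_above : ∀ l, k < l → IsEmpty (Grouping l)
  /-- the one grouping at level `k` -/
  head : Grouping k
  head_unique : ∀ g : Grouping k, g = head
  numExits : ∀ {l : ℕ}, Grouping l → ℕ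
  numMids : ∀ {l : ℕ}, Grouping (l + 1) → ℕ
  /-- the left (`false`) and the right (`true`) branch of a level-`0` grouping -/
  branch : ∀ g : Grouping 0, Bool → Fin (numExits g)
  /-- a level-`0` grouping is a don't-care grouping or a fork grouping -/
  dontCare_or_fork : ∀ g : Grouping 0, numExits g = 1 ∨
    (numExits g = 2 ∧ (branch g false : ℕ) = 0 ∧ (branch g true : ℕ) = 1)
  /-- the target of the A-call edge -/
  aCall : ∀ {l : ℕ}, Grouping (l + 1) → Grouping l
  /-- the A-return edges -/
  aRet : ∀ {l : ℕ} (g : Grouping (l + 1)), Fin (numExits (aCall g)) → Fin (numMids g)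
  /-- the target of the B-call edge that leaves a middle vertex -/
  bCall : ∀ {l : ℕ} (g : Grouping (l + 1)), Fin (numMids g) → Grouping l
  /-- the B-return edges that match the B-call edge of a middle vertex -/
  bRet : ∀ {l : ℕ} (g : Grouping (l + 1)) (m : Fin (numMids g)),
    Fin (numExits (bCall g m)) → Fin (numExits g)
  /-- every grouping below level `k` is called; hence every grouping is connected to the head -/
  called : ∀ {l : ℕ}, l < k → ∀ g : Grouping l,
    ∃ h : Grouping (l + 1), aCall h = g ∨ ∃ m, bCall h m = g
  /-- the value edges -/
  value : Fin (numExits head) → V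

namespace MockCFLOBDD

variable {V : Type u} {k : ℕ}

/-- Every grouping has at least one exit vertex. -/
theorem numExits_pos (C : MockCFLOBDD V k) : ∀ {l : ℕ} (g : C.Grouping l), 0 < C.numExits g
  | 0, g => (Nat.zero_le _).trans_lt (C.branch g false).isLt
  | _ + 1, g =>
    let m := C.aRet g ⟨0, C.numExits_pos (C.aCall g)⟩
    (Nat.zero_le _).trans_lt (C.bRet g m ⟨0, C.numExits_pos (C.bCall g m)⟩).isLt

/-- The exit vertex at which the matched path for `a` through the proto-CFLOBDD headed by `g`
ends.  At level `0` the next variable selects the branch.  At level `l + 1` the path follows the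
A-call edge, reads the first half of `a` in the A-callee, returns along the matching A-return edge
to a middle vertex `m`, follows the B-call edge of `m`, reads the second half of `a` in that
B-callee, and returns along the matching B-return edge. -/
def run (C : MockCFLOBDD V k) :
    {l : ℕ} → (g : C.Grouping l) → (Fin (2 ^ l) → Bool) → Fin (C.numExits g)
  | 0, g, a => C.branch g (a ⟨0, by norm_num⟩)
  | l + 1, g, a =>
    let m := C.aRet g (C.run (C.aCall g) fun i => a ⟨i, by have := i.isLt; rw [pow_succ]; omega⟩)
    C.bRet g m (C.run (C.bCall g m) fun i => a ⟨2 ^ l + i, by have := i.isLt; rw [pow_succ]; omega⟩)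

/-- The interpretation of an assignment, given as the sequence of Booleans in reading order. -/
def eval (C : MockCFLOBDD V k) (a : Fin (2 ^ k) → Bool) : V :=
  C.value (C.run C.head a)

/-- `C` represents `f` with the variable ordering `ord`: the variable read in step `i` is
the variable number `ord i` of `f`. -/
def Represents (C : MockCFLOBDD V k) (ord : Equiv.Perm (Fin (2 ^ k)))
    (f : (Fin (2 ^ k) → Bool) → V) : Prop :=
  ∀ x : Fin (2 ^ k) → Bool, C.eval (fun i => x (ord i)) = f x

/-- The number of groupings. -/
noncomputable def numGroupings (C : MockCFLOBDD V k) : ℕ :=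
  Nat.card (Σ l, C.Grouping l)

/-- The return tuple of the A-call edge (indices start at `1`). -/
def aTuple (C : MockCFLOBDD V k) {l : ℕ} (g : C.Grouping (l + 1)) : List ℕ :=
  List.ofFn fun e => (C.aRet g e : ℕ) + 1

/-- The return tuple of the B-call edge of the middle vertex `m` (indices start at `1`). -/
def bTuple (C : MockCFLOBDD V k) {l : ℕ} (g : C.Grouping (l + 1)) (m : Fin (C.numMids g)) :
    List ℕ :=
  List.ofFn fun e => (C.bRet g m e : ℕ) + 1

/-- The largest index (starting at `1`) of an exit vertex of `g` that occurs in the return tuples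
of the B-connections of the middle vertices before `m`; it is `0` if there is none. -/
def lastExitBefore (C : MockCFLOBDD V k) {l : ℕ} (g : C.Grouping (l + 1))
    (m : Fin (C.numMids g)) : ℕ :=
  (Finset.univ.filter fun i : Fin (C.numMids g) => i < m).sup fun i =>
    Finset.univ.sup fun e => (C.bRet g i e : ℕ) + 1

/-- Equality (up to isomorphism) of the proto-CFLOBDDs headed by two groupings, defined along
their hierarchical structure. -/
def SameProto (C : MockCFLOBDD V k) : {l : ℕ} → C.Grouping l → C.Grouping l → Prop
  | 0, g, h => C.numExits g = C.numExits h ∧ ∀ b, (C.branch g b : ℕ) = C.branch h b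
  | _ + 1, g, h =>
    C.numExits g = C.numExits h ∧ C.numMids g = C.numMids h ∧
    C.SameProto (C.aCall g) (C.aCall h) ∧ C.aTuple g = C.aTuple h ∧
    ∀ (i : Fin (C.numMids g)) (j : Fin (C.numMids h)), (i : ℕ) = j →
      C.SameProto (C.bCall g i) (C.bCall h j) ∧ C.bTuple g i = C.bTuple h j

end MockCFLOBDD

/-- A CFLOBDD at level `k`: a mock-CFLOBDD that satisfies the structural invariants. -/
structure CFLOBDD (V : Type u) (k : ℕ) extends MockCFLOBDD V k where
  /-- an A-call edge maps the exit vertices of its target identically onto the middle vertices -/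
  a_identity : ∀ {l : ℕ} (g : Grouping (l + 1)),
    numMids g = numExits (aCall g) ∧
      toMockCFLOBDD.aTuple g = List.range' 1 (numExits (aCall g))
  /-- there are no repetitions in the return tuple of a B-call edge -/
  b_injective : ∀ {l : ℕ} (g : Grouping (l + 1)) (m : Fin (numMids g)),
    Function.Injective (bRet g m)
  /-- the return tuple of a B-call edge compactly extends the earlier ones: the sub-sequence of
  its entries greater than `n` is `[n + 1, n + 2, …]`, where `n` is the largest earlier entry -/
  b_compact : ∀ {l : ℕ} (g : Grouping (l + 1)) (m : Fin (numMids g)),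
    let n := toMockCFLOBDD.lastExitBefore g m
    let R := (toMockCFLOBDD.bTuple g m).filter fun i => n < i
    R = List.range' (n + 1) R.length
  /-- the exit vertices are those defined by the return tuples of the B-connections -/
  exits_defined : ∀ {l : ℕ} (g : Grouping (l + 1)) (e : Fin (numExits g)),
    ∃ (m : Fin (numMids g)) (e' : Fin (numExits (bCall g m))), bRet g m e' = e
  /-- there are no two separate instances of equal proto-CFLOBDDs -/
  no_duplicates : ∀ {l : ℕ} (g h : Grouping l), toMockCFLOBDD.SameProto g h → g = h
  /-- two B-call edges of a grouping that lead to equal proto-CFLOBDDs have different return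
  tuples -/
  b_distinct : ∀ {l : ℕ} (g : Grouping (l + 1)) (i j : Fin (numMids g)), i ≠ j →
    toMockCFLOBDD.SameProto (bCall g i) (bCall g j) →
      toMockCFLOBDD.bTuple g i ≠ toMockCFLOBDD.bTuple g j
  /-- the value tuple maps the exit vertices of the head to distinct values -/
  value_injective : Function.Injective value

/-! A grouping at level `l` partitions the assignments to its `2 ^ l` variables by the exit reached;
a BDD node partitions them by the node reached after `2 ^ l` steps. Two facts connect these
partitions.

Canonicity (`eq_of_sameKernel`): the structural invariants force a grouping to be determined by its
level and partition. By induction on the level, the partition fixes the A-callee, then each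
B-callee, and finally the return tuples, since new exits are numbered in order of first use.

Realization (`exists_realizedAt`): every grouping has the partition of some node of `B`. The head
matches the root, an A-callee matches the same node as its caller, and a B-callee matches a node `2
^ l` steps further down.

Hence (level, node) determines the grouping, and there are at most `(k + 1) * M` groupings, `M`
being the number of non-terminal nodes. As no ply is skipped, `M ≥ 2 ^ k`, so `k + 1` is logarithmic
in the size of `B`. -/

/-! ### Walks in a BDD and counts of its nodes -/

namespace BDD

variable {V : Type u} {n : ℕ}

open Classical in
/-- One step in a BDD, on nodes bundled with their depth; terminal nodes stay put. -/
noncomputable def step (B : BDD V n) (u : Σ d, B.Node d) (b : Bool) : Σ d, B.Node d :=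
  if h : u.1 < n then ⟨u.1 + 1, B.succ h u.2 b⟩ else u

/-- The node reached from `u` by reading a list of Booleans. -/
noncomputable def walk (B : BDD V n) (u : Σ d, B.Node d) (L : List Bool) : Σ d, B.Node d :=
  L.foldl B.step u

theorem walk_append (B : BDD V n) (u : Σ d, B.Node d) (L M : List Bool) :
    B.walk u (L ++ M) = B.walk (B.walk u L) M :=
  List.foldl_append

theorem step_of_lt (B : BDD V n) {d : ℕ} (h : d < n) (u : B.Node d) (b : Bool) :
    B.step ⟨d, u⟩ b = ⟨d + 1, B.succ h u b⟩ :=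
  dif_pos h

theorem step_fst (B : BDD V n) (u : Σ d, B.Node d) (h : u.1 < n) (b : Bool) :
    (B.step u b).1 = u.1 + 1 := by
  rw [step, dif_pos h]

theorem walk_fst (B : BDD V n) (L : List Bool) :
    ∀ u : Σ d, B.Node d, u.1 + L.length ≤ n → (B.walk u L).1 = u.1 + L.length := by
  induction L with
  | nil => intro u _; rfl
  | cons b L ih =>
    intro u hu
    rw [List.length_cons] at hu ⊢
    have h1 := B.step_fst u (by omega) b
    have h2 := ih (B.step u b) (by omega)
    change (B.walk (B.step u b) L).1 = _
    omega

/-- Nodes of equal depth are separated by the lists of any fixed length that can be read. -/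
theorem eq_of_walk_eq (B : BDD V n) (m : ℕ) :
    ∀ u v : Σ d, B.Node d, u.1 = v.1 → u.1 + m ≤ n →
      (∀ L : List Bool, L.length = m → B.walk u L = B.walk v L) → u = v := by
  induction m with
  | zero => intro u v _ _ h; exact h [] rfl
  | succ m ih =>
    rintro ⟨d, u⟩ ⟨d', v⟩ rfl hm h
    have hd : d < n := by simp only at hm; omega
    congr 1
    refine B.node_shared hd u v fun b => ?_
    have := ih (B.step ⟨d, u⟩ b) (B.step ⟨d, v⟩ b)
      (by rw [B.step_fst _ hd, B.step_fst _ hd])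
      (by rw [B.step_fst _ hd]; simp only at hm ⊢; omega)
      (fun L hL => h (b :: L) (by simp [hL]))
    rw [B.step_of_lt hd, B.step_of_lt hd] at this
    simpa using this

theorem walk_root (B : BDD V n) (a : Fin n → Bool) :
    ∀ (d : ℕ) (h : d ≤ n), B.walk ⟨0, B.root⟩ (List.ofFn fun i : Fin d => a (i.castLE h)) =
      ⟨d, B.nodeAfter a d h⟩ := by
  intro d
  induction d with
  | zero => intro h; rfl
  | succ d ih =>
    intro h
    rw [List.ofFn_succ', List.concat_eq_append, walk_append]
    have := ih (Nat.le_of_succ_le h)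
    simp only [Fin.castLE_castSucc] at this ⊢
    rw [this]
    exact B.step_of_lt h _ _

theorem walk_root_eq_iff (B : BDD V n) (a a' : Fin n → Bool) :
    B.walk ⟨0, B.root⟩ (List.ofFn a) = B.walk ⟨0, B.root⟩ (List.ofFn a') ↔
      B.eval a = B.eval a' := by
  have h1 := B.walk_root a n le_rfl
  have h2 := B.walk_root a' n le_rfl
  simp only [Fin.castLE_rfl, id] at h1 h2
  rw [h1, h2, eval, eval, B.value_shared.eq_iff]
  simp

theorem nonempty_node (B : BDD V n) : ∀ d, d ≤ n → Nonempty (B.Node d)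
  | 0, _ => ⟨B.root⟩
  | d + 1, h =>
    let ⟨u⟩ := B.nonempty_node d (Nat.le_of_succ_le h)
    ⟨B.succ h u false⟩

/-- Each of the depths `0, …, n - 1` contributes a node. With `n = 2 ^ k` this makes the number of
levels logarithmic in the size of the BDD. -/
theorem le_card_nonterminal (B : BDD V n) : n ≤ Nat.card {u : Σ d, B.Node d // u.1 < n} := by
  have := B.finite_nodes
  let x : ∀ i : Fin n, B.Node i := fun i => (B.nonempty_node i i.isLt.le).some
  have := Nat.card_le_card_of_injective
    (fun i : Fin n => (⟨⟨i, x i⟩, i.isLt⟩ : {u : Σ d, B.Node d // u.1 < n}))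
    (fun i j h => by
      have := congrArg (fun u : {u : Σ d, B.Node d // u.1 < n} => u.1.1) h
      exact Fin.ext this)
  simpa using this

theorem card_nonterminal_lt_numNodes (B : BDD V n) :
    Nat.card {u : Σ d, B.Node d // u.1 < n} < B.numNodes := by
  have := B.finite_nodes
  obtain ⟨x⟩ := B.nonempty_node n le_rfl
  exact Finite.card_subtype_lt (x := (⟨n, x⟩ : Σ d, B.Node d)) (lt_irrefl n)

theorem numEdges_eq (B : BDD V n) :
    B.numEdges = Nat.card {u : Σ d, B.Node d // u.1 < n} * 2 := by
  simp [numEdges, Nat.card_prod]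

end BDD

/-! ### Concatenated assignments and comparison of return tuples -/

/-- The concatenation of two assignments to `2 ^ l` variables. -/
def glue {l : ℕ} (a b : Fin (2 ^ l) → Bool) : Fin (2 ^ (l + 1)) → Bool := fun i =>
  Fin.append a b (i.cast (by rw [pow_succ]; omega))

theorem ofFn_glue {l : ℕ} (a b : Fin (2 ^ l) → Bool) :
    List.ofFn (glue a b) = List.ofFn a ++ List.ofFn b := by
  rw [← List.ofFn_fin_append, List.ofFn_congr (by omega : 2 ^ (l + 1) = 2 ^ l + 2 ^ l)]
  rfl

theorem glue_left {l : ℕ} (a b : Fin (2 ^ l) → Bool) (i : Fin (2 ^ l)) (h) :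
    glue a b ⟨i, h⟩ = a i :=
  Fin.append_left a b i

theorem glue_right {l : ℕ} (a b : Fin (2 ^ l) → Bool) (i : Fin (2 ^ l)) (h) :
    glue a b ⟨2 ^ l + i, h⟩ = b i :=
  Fin.append_right a b i

/-- Lists that agree up to entries above `n`, and whose entries above `n` form the same
subsequence, are equal. -/
theorem List.eq_of_forall₂_of_filter_eq {n : ℕ} {L M : List ℕ}
    (h : List.Forall₂ (fun x y => x = y ∨ (n < x ∧ n < y)) L M)
    (hf : (L.filter fun i => n < i) = M.filter fun i => n < i) : L = M := by
  induction h with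
  | nil => rfl
  | @cons x y L M hxy _ ih =>
    rcases hxy with rfl | ⟨hx, hy⟩
    · by_cases hx : n < x <;> simp [hx] at hf <;> rw [ih (by simpa using hf)]
    · simp [hx, hy] at hf
      rw [hf.1, ih (by simpa using hf.2)]

/-- Compactness fixes the new entries of a return tuple only up to their number; this supplies the
number. -/
theorem List.Forall₂.length_filter_eq {n : ℕ} {L M : List ℕ}
    (h : List.Forall₂ (fun x y => x = y ∨ (n < x ∧ n < y)) L M) :
    (L.filter fun i => n < i).length = (M.filter fun i => n < i).length := by
  induction h with
  | nil => rfl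
  | @cons x y L M hxy _ ih =>
    rcases hxy with rfl | ⟨hx, hy⟩
    · by_cases hx : n < x <;> simp [hx] <;> simpa using ih
    · simp [hx, hy]; simpa using ih

/-! ### Matched paths through a grouping -/

namespace MockCFLOBDD

variable {V : Type u} {k : ℕ}

theorem run_glue (C : MockCFLOBDD V k) {l : ℕ} (g : C.Grouping (l + 1))
    (a b : Fin (2 ^ l) → Bool) :
    C.run g (glue a b) =
      C.bRet g (C.aRet g (C.run (C.aCall g) a)) (C.run (C.bCall g _) b) := by
  have ha : (fun i : Fin (2 ^ l) => glue a b ⟨i, by have := i.isLt; rw [pow_succ]; omega⟩) = a :=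
    funext fun i => glue_left a b i _
  have hb : (fun i : Fin (2 ^ l) =>
      glue a b ⟨2 ^ l + i, by have := i.isLt; rw [pow_succ]; omega⟩) = b :=
    funext fun i => glue_right a b i _
  rw [run, hb, ha]

/-- The path through `g` that enters the B-callee of `m`. -/
theorem run_glue_of_mid (C : MockCFLOBDD V k) {l : ℕ} (g : C.Grouping (l + 1))
    (a b : Fin (2 ^ l) → Bool) (m : Fin (C.numMids g)) (h : C.aRet g (C.run (C.aCall g) a) = m) :
    C.run g (glue a b) = C.bRet g m (C.run (C.bCall g m) b) := by
  subst h; exact C.run_glue g a b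

theorem mem_bTuple (C : MockCFLOBDD V k) {l : ℕ} (g : C.Grouping (l + 1))
    (m : Fin (C.numMids g)) (x : ℕ) :
    x ∈ C.bTuple g m ↔ ∃ e, (C.bRet g m e : ℕ) + 1 = x := by
  simp [bTuple, List.mem_ofFn]

theorem le_lastExitBefore_iff (C : MockCFLOBDD V k) {l : ℕ} (g : C.Grouping (l + 1))
    (m : Fin (C.numMids g)) (x : ℕ) (hx : 0 < x) :
    x ≤ C.lastExitBefore g m ↔ ∃ i < m, ∃ e, x ≤ (C.bRet g i e : ℕ) + 1 := by
  simp [lastExitBefore, Finset.le_sup_iff (show (⊥ : ℕ) < x from hx)]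

theorem run_val_congr (C : MockCFLOBDD V k) {l : ℕ} {g h : C.Grouping l} (e : g = h)
    (a : Fin (2 ^ l) → Bool) : (C.run g a : ℕ) = C.run h a := by
  rw [e]

theorem sameProto_refl (C : MockCFLOBDD V k) : ∀ {l : ℕ} (g : C.Grouping l), C.SameProto g g
  | 0, _ => ⟨rfl, fun _ => rfl⟩
  | _ + 1, g => by
    refine ⟨rfl, rfl, C.sameProto_refl _, rfl, fun i j hij => ?_⟩
    obtain rfl := Fin.ext hij
    exact ⟨C.sameProto_refl _, rfl⟩

end MockCFLOBDD

/-! ### Consequences of the structural invariants -/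

namespace CFLOBDD

variable {V : Type u} {k : ℕ}

theorem aRet_val (C : CFLOBDD V k) {l : ℕ} (g : C.Grouping (l + 1))
    (e : Fin (C.numExits (C.aCall g))) : (C.aRet g e : ℕ) = e := by
  have h := (C.a_identity g).2
  have h2 := congrArg (fun L => L[(e : ℕ)]?) h
  simp [MockCFLOBDD.aTuple] at h2
  omega

theorem aRet_injective (C : CFLOBDD V k) {l : ℕ} (g : C.Grouping (l + 1)) :
    Function.Injective (C.aRet g) := fun e e' h =>
  Fin.ext (by rw [← C.aRet_val g e, h, C.aRet_val])

theorem aRet_surjective (C : CFLOBDD V k) {l : ℕ} (g : C.Grouping (l + 1)) :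
    Function.Surjective (C.aRet g) := fun m =>
  ⟨⟨m, (C.a_identity g).1 ▸ m.isLt⟩, Fin.ext (C.aRet_val g _)⟩

/-- Every exit is a B-return target and every middle vertex an A-return target, so paths to them are
built by induction. This turns statements about exits into statements about assignments. -/
theorem run_surjective (C : CFLOBDD V k) :
    ∀ {l : ℕ} (g : C.Grouping l), Function.Surjective (C.run g)
  | 0, g => fun e => by
    have he := e.isLt
    rcases C.dontCare_or_fork g with h | ⟨h, h0, h1⟩
    · have := (C.branch g false).isLt
      exact ⟨fun _ => false, Fin.ext (by rw [MockCFLOBDD.run]; omega)⟩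
    · rcases (by omega : (e : ℕ) = 0 ∨ (e : ℕ) = 1) with h' | h'
      · exact ⟨fun _ => false, Fin.ext (by rw [MockCFLOBDD.run]; omega)⟩
      · exact ⟨fun _ => true, Fin.ext (by rw [MockCFLOBDD.run]; omega)⟩
  | l + 1, g => fun e => by
    obtain ⟨m, e', rfl⟩ := C.exits_defined g e
    obtain ⟨c, hc⟩ := C.aRet_surjective g m
    obtain ⟨a, rfl⟩ := C.run_surjective _ c
    obtain ⟨b, rfl⟩ := C.run_surjective _ e'
    exact ⟨glue a b, C.run_glue_of_mid g a b m hc⟩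

theorem exists_run_eq_mid (C : CFLOBDD V k) {l : ℕ} (g : C.Grouping (l + 1))
    (m : Fin (C.numMids g)) : ∃ a, C.aRet g (C.run (C.aCall g) a) = m := by
  obtain ⟨c, hc⟩ := C.aRet_surjective g m
  obtain ⟨a, rfl⟩ := C.run_surjective _ c
  exact ⟨a, hc⟩

/-- The exits up to the largest one that is used before `m` are all used before `m`. -/
theorem exists_bRet_of_le_lastExitBefore (C : CFLOBDD V k) {l : ℕ} (g : C.Grouping (l + 1)) :
    ∀ (m : Fin (C.numMids g)) (x : ℕ), 0 < x → x ≤ C.lastExitBefore g m →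
      ∃ i < m, ∃ e, (C.bRet g i e : ℕ) + 1 = x := by
  intro m
  induction m using WellFoundedLT.induction with
  | ind m ih =>
    intro x hx hxm
    obtain ⟨i, him, e, hxe⟩ := (C.le_lastExitBefore_iff g m x hx).1 hxm
    by_cases hxi : x ≤ C.lastExitBefore g i
    · obtain ⟨j, hj, he⟩ := ih i him x hx hxi
      exact ⟨j, hj.trans him, he⟩
    -- Here `x` is new at `i`. The new entries form a gapless run from `lastExitBefore g i + 1` that
    -- includes an entry at least `x`, so they include `x`.
    · have hR := C.b_compact g i
      simp only at hR
      have hy : (C.bRet g i e : ℕ) + 1 ∈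
          (C.bTuple g i).filter fun y => C.lastExitBefore g i < y := by
        simp only [List.mem_filter, C.mem_bTuple, decide_eq_true_eq]
        exact ⟨⟨e, rfl⟩, by omega⟩
      rw [hR, List.mem_range'_1] at hy
      have hx' : x ∈ (C.bTuple g i).filter fun y => C.lastExitBefore g i < y := by
        rw [hR, List.mem_range'_1]; omega
      exact ⟨i, him, (C.mem_bTuple g i x).1 (List.mem_filter.1 hx').1⟩

/-! ### Canonicity: the partition determines the grouping -/

/-- `g` and `h` identify the same pairs of assignments. -/
def SameKernel (C : CFLOBDD V k) {l : ℕ} (g h : C.Grouping l) : Prop :=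
  ∀ a a', C.run g a = C.run g a' ↔ C.run h a = C.run h a'

theorem SameKernel.symm {C : CFLOBDD V k} {l : ℕ} {g h : C.Grouping l} (H : C.SameKernel g h) :
    C.SameKernel h g := fun a a' => (H a a').symm

/-- If kernels determine the groupings at level `l`, then the A-callee of a grouping at level
`l + 1` identifies two prefixes only if the grouping does so after every suffix. -/
theorem run_aCall_eq_iff (C : CFLOBDD V k) {l : ℕ}
    (canon : ∀ g h : C.Grouping l, C.SameKernel g h → g = h)
    (g : C.Grouping (l + 1)) (a a' : Fin (2 ^ l) → Bool) :
    C.run (C.aCall g) a = C.run (C.aCall g) a' ↔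
      ∀ b, C.run g (glue a b) = C.run g (glue a' b) := by
  constructor
  · intro h b
    rw [C.run_glue_of_mid g a b _ rfl, C.run_glue_of_mid g a' b _ (congrArg _ h.symm)]
  · intro h
    by_contra hne
    obtain ⟨m, hm⟩ : ∃ m, C.aRet g (C.run (C.aCall g) a) = m := ⟨_, rfl⟩
    obtain ⟨m', hm'⟩ : ∃ m, C.aRet g (C.run (C.aCall g) a') = m := ⟨_, rfl⟩
    have hmm : m ≠ m' := fun e => hne (C.aRet_injective g (by rw [hm, hm', e]))
    have hb : ∀ b, C.bRet g m (C.run (C.bCall g m) b) = C.bRet g m' (C.run (C.bCall g m') b) := by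
      intro b
      rw [← C.run_glue_of_mid g a b m hm, ← C.run_glue_of_mid g a' b m' hm', h]
    -- Injective B-returns transfer the coincidence `hb` to the kernels of the callees. Equal
    -- callees then have equal return tuples, which `b_distinct` forbids.
    have hc : C.bCall g m = C.bCall g m' := canon _ _ fun b b' => by
      rw [← (C.b_injective g m).eq_iff, hb, hb, (C.b_injective g m').eq_iff]
    refine C.b_distinct g m m' hmm (hc ▸ C.sameProto_refl _) ?_
    refine List.ext_getElem (by simp [MockCFLOBDD.bTuple, hc]) fun i hi hi' => ?_
    simp only [MockCFLOBDD.bTuple, List.length_ofFn] at hi hi'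
    obtain ⟨b, hbi⟩ := C.run_surjective (C.bCall g m) ⟨i, hi⟩
    have hbi' : C.run (C.bCall g m') b = ⟨i, hi'⟩ :=
      Fin.ext (by rw [← C.run_val_congr hc, hbi])
    have := hb b
    rw [hbi, hbi'] at this
    simp [MockCFLOBDD.bTuple, this]

section Canonicity

variable (C : CFLOBDD V k) {l : ℕ} (canon : ∀ g h : C.Grouping l, C.SameKernel g h → g = h)
  {g h : C.Grouping (l + 1)} (H : C.SameKernel g h)

include canon H

theorem aCall_eq_of_sameKernel : C.aCall g = C.aCall h :=
  canon _ _ fun a a' => by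
    rw [C.run_aCall_eq_iff canon, C.run_aCall_eq_iff canon]
    exact forall_congr' fun b => H _ _

theorem numMids_eq_of_sameKernel : C.numMids g = C.numMids h := by
  rw [(C.a_identity g).1, (C.a_identity h).1, C.aCall_eq_of_sameKernel canon H]

theorem exists_run_eq_mids_of_sameKernel (i : Fin (C.numMids g)) (i' : Fin (C.numMids h))
    (hi : (i : ℕ) = i') :
    ∃ a, C.aRet g (C.run (C.aCall g) a) = i ∧ C.aRet h (C.run (C.aCall h) a) = i' := by
  obtain ⟨a, ha⟩ := C.exists_run_eq_mid g i
  refine ⟨a, ha, Fin.ext ?_⟩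
  rw [C.aRet_val, ← hi, ← ha, C.aRet_val,
    C.run_val_congr (C.aCall_eq_of_sameKernel canon H)]

/-- Since B-returns are injective, the kernel of a B-callee is that of the caller restricted to a
fixed prefix leading to the middle vertex. -/
theorem bCall_eq_of_sameKernel (i : Fin (C.numMids g)) (i' : Fin (C.numMids h))
    (hi : (i : ℕ) = i') : C.bCall g i = C.bCall h i' := by
  obtain ⟨a, ha, ha'⟩ := C.exists_run_eq_mids_of_sameKernel canon H i i' hi
  refine canon _ _ fun b b' => ?_
  rw [← (C.b_injective g i).eq_iff, ← (C.b_injective h i').eq_iff,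
    ← C.run_glue_of_mid g a b i ha, ← C.run_glue_of_mid g a b' i ha,
    ← C.run_glue_of_mid h a b i' ha', ← C.run_glue_of_mid h a b' i' ha']
  exact H _ _

theorem exists_run_eq_of_sameKernel (i : Fin (C.numMids g)) (i' : Fin (C.numMids h))
    (hi : (i : ℕ) = i') (e : Fin (C.numExits (C.bCall g i)))
    (e' : Fin (C.numExits (C.bCall h i'))) (he : (e : ℕ) = e') :
    ∃ a, C.run g a = C.bRet g i e ∧ C.run h a = C.bRet h i' e' := by
  obtain ⟨a, ha, ha'⟩ := C.exists_run_eq_mids_of_sameKernel canon H i i' hi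
  obtain ⟨b, rfl⟩ := C.run_surjective _ e
  have hb : C.run (C.bCall h i') b = e' :=
    Fin.ext (by rw [← he, C.run_val_congr (C.bCall_eq_of_sameKernel canon H i i' hi)])
  exact ⟨glue a b, C.run_glue_of_mid g a b i ha, by rw [C.run_glue_of_mid h a b i' ha', hb]⟩

theorem bRet_eq_iff_of_sameKernel (i j : Fin (C.numMids g)) (i' j' : Fin (C.numMids h))
    (hi : (i : ℕ) = i') (hj : (j : ℕ) = j') (e : Fin (C.numExits (C.bCall g i)))
    (e' : Fin (C.numExits (C.bCall h i'))) (he : (e : ℕ) = e')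
    (f : Fin (C.numExits (C.bCall g j)))
    (f' : Fin (C.numExits (C.bCall h j'))) (hf : (f : ℕ) = f') :
    C.bRet g i e = C.bRet g j f ↔ C.bRet h i' e' = C.bRet h j' f' := by
  obtain ⟨a, ha, ha'⟩ := C.exists_run_eq_of_sameKernel canon H i i' hi e e' he
  obtain ⟨b, hb, hb'⟩ := C.exists_run_eq_of_sameKernel canon H j j' hj f f' hf
  rw [← ha, ← hb, ← ha', ← hb']
  exact H a b

/-- If the return tuples before `i` agree, then a return edge of `i` to an exit that has been used
before has the same target in `h`. -/
theorem bRet_eq_of_le_lastExitBefore (i : Fin (C.numMids g)) (i' : Fin (C.numMids h))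
    (hi : (i : ℕ) = i')
    (ih : ∀ (j : Fin (C.numMids g)) (j' : Fin (C.numMids h)), (j : ℕ) = j' → j < i →
      ∀ (f : Fin _) (f' : Fin _), (f : ℕ) = f' → (C.bRet g j f : ℕ) = C.bRet h j' f')
    (e : Fin (C.numExits (C.bCall g i))) (e' : Fin (C.numExits (C.bCall h i')))
    (he : (e : ℕ) = e') (hle : (C.bRet g i e : ℕ) + 1 ≤ C.lastExitBefore g i) :
    (C.bRet g i e : ℕ) = C.bRet h i' e' := by
  obtain ⟨j, hj, f, hf⟩ := C.exists_bRet_of_le_lastExitBefore g i _ (Nat.succ_pos _) hle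
  have hM := C.numMids_eq_of_sameKernel canon H
  let j' : Fin (C.numMids h) := j.cast hM
  have hB := C.bCall_eq_of_sameKernel canon H j j' rfl
  let f' : Fin (C.numExits (C.bCall h j')) := f.cast (by rw [hB])
  have h1 : C.bRet g j f = C.bRet g i e := Fin.ext (by omega)
  have h2 := (C.bRet_eq_iff_of_sameKernel canon H j i j' i' rfl hi f f' rfl e e' he).1 h1
  rw [← h1, ← h2]
  exact ih j j' rfl hj f f' rfl

/-- Strong induction on the middle vertex. A target already used is fixed by its earlier occurrence;
the new targets are consecutive from the same starting point, so their positions in the tuple fix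
them. -/
theorem bRet_val_eq_of_sameKernel :
    ∀ (i : Fin (C.numMids g)) (i' : Fin (C.numMids h)), (i : ℕ) = i' →
      ∀ (e : Fin _) (e' : Fin _), (e : ℕ) = e' → (C.bRet g i e : ℕ) = C.bRet h i' e' := by
  intro i
  induction i using WellFoundedLT.induction with
  | ind i ih =>
    intro i' hi
    have hM := C.numMids_eq_of_sameKernel canon H
    have hB := C.bCall_eq_of_sameKernel canon H i i' hi
    have hn : C.lastExitBefore g i = C.lastExitBefore h i' := by
      have key : ∀ x, 0 < x → (x ≤ C.lastExitBefore g i ↔ x ≤ C.lastExitBefore h i') := by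
        intro x hx
        rw [C.le_lastExitBefore_iff g i x hx, C.le_lastExitBefore_iff h i' x hx]
        constructor
        · rintro ⟨j, hj, f, hf⟩
          have hBj := C.bCall_eq_of_sameKernel canon H j (j.cast hM) rfl
          refine ⟨j.cast hM, ?_, f.cast (by rw [hBj]), ?_⟩
          · rw [Fin.lt_def] at hj ⊢; simpa [← hi] using hj
          · rwa [← ih j hj (j.cast hM) rfl f _ rfl]
        · rintro ⟨j, hj, f, hf⟩
          have hj' : j.cast hM.symm < i := by
            rw [Fin.lt_def] at hj ⊢; simpa [hi] using hj
          have hBj := C.bCall_eq_of_sameKernel canon H (j.cast hM.symm) j rfl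
          refine ⟨j.cast hM.symm, hj', f.cast (by rw [hBj]), ?_⟩
          rwa [ih _ hj' j rfl _ f rfl]
      refine le_antisymm ?_ ?_
      · by_contra hlt
        exact absurd ((key _ (by omega)).1 le_rfl) hlt
      · by_contra hlt
        exact absurd ((key _ (by omega)).2 le_rfl) hlt
    -- At each position the targets agree, or both are new. If either one is old, agreement follows
    -- from the grouping in which it is old.
    have h2 : List.Forall₂ (fun x y => x = y ∨
        (C.lastExitBefore g i < x ∧ C.lastExitBefore g i < y)) (C.bTuple g i) (C.bTuple h i') := by
      rw [List.forall₂_iff_get]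
      refine ⟨by simp [MockCFLOBDD.bTuple, hB], fun x hx hx' => ?_⟩
      simp only [MockCFLOBDD.bTuple, List.get_ofFn]
      simp only [MockCFLOBDD.bTuple, List.length_ofFn] at hx hx'
      change (C.bRet g i ⟨x, hx⟩ : ℕ) + 1 = C.bRet h i' ⟨x, hx'⟩ + 1 ∨
        (_ < (C.bRet g i ⟨x, hx⟩ : ℕ) + 1 ∧ _ < (C.bRet h i' ⟨x, hx'⟩ : ℕ) + 1)
      by_cases hg : (C.bRet g i ⟨x, hx⟩ : ℕ) + 1 ≤ C.lastExitBefore g i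
      · left
        rw [C.bRet_eq_of_le_lastExitBefore canon H i i' hi
          (fun j j' hj hlt f f' hf => ih j hlt j' hj f f' hf) _ ⟨x, hx'⟩ rfl hg]
      · by_cases hh : (C.bRet h i' ⟨x, hx'⟩ : ℕ) + 1 ≤ C.lastExitBefore h i'
        · left
          rw [C.bRet_eq_of_le_lastExitBefore canon H.symm i' i hi.symm
            (fun j j' hj hlt f f' hf => (ih j' (by rw [Fin.lt_def] at hlt ⊢; omega) j hj.symm
              f' f hf.symm).symm) _ ⟨x, hx⟩ rfl hh]
        · right; omega
    have hR := C.b_compact g i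
    have hR' := C.b_compact h i'
    simp only at hR hR'
    rw [← hn, ← h2.length_filter_eq] at hR'
    have hT := List.eq_of_forall₂_of_filter_eq h2 (hR.trans hR'.symm)
    intro e e' he
    have := congrArg (fun L => L[(e : ℕ)]?) hT
    have he1 : (e : ℕ) < C.numExits (C.bCall h i') := he ▸ e'.isLt
    have he2 : (⟨e, he1⟩ : Fin (C.numExits (C.bCall h i'))) = e' := Fin.ext he
    simpa [MockCFLOBDD.bTuple, he1, he2] using this

theorem numExits_le_of_sameKernel : C.numExits g ≤ C.numExits h := by
  have hpos := C.numExits_pos g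
  obtain ⟨m, e, he⟩ := C.exits_defined g ⟨C.numExits g - 1, by omega⟩
  have hM := C.numMids_eq_of_sameKernel canon H
  have hB := C.bCall_eq_of_sameKernel canon H m (m.cast hM) rfl
  have h1 := C.bRet_val_eq_of_sameKernel canon H m (m.cast hM) rfl e (e.cast (by rw [hB])) rfl
  have h2 := (C.bRet h (m.cast hM) (e.cast (by rw [hB]))).isLt
  rw [he] at h1
  simp only at h1
  omega

theorem sameProto_of_sameKernel_succ : C.SameProto g h := by
  have hA := C.aCall_eq_of_sameKernel canon H
  refine ⟨le_antisymm (C.numExits_le_of_sameKernel canon H)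
      (C.numExits_le_of_sameKernel canon H.symm), C.numMids_eq_of_sameKernel canon H,
    hA ▸ C.sameProto_refl _, ?_, fun i j hij => ?_⟩
  · rw [(C.a_identity g).2, (C.a_identity h).2, hA]
  · have hB := C.bCall_eq_of_sameKernel canon H i j hij
    refine ⟨hB ▸ C.sameProto_refl _, List.ext_getElem (by simp [MockCFLOBDD.bTuple, hB]) ?_⟩
    intro x hx hx'
    simp only [MockCFLOBDD.bTuple, List.length_ofFn] at hx hx'
    simpa [MockCFLOBDD.bTuple] using
      C.bRet_val_eq_of_sameKernel canon H i j hij ⟨x, hx⟩ ⟨x, hx'⟩ rfl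

end Canonicity

/-- Canonicity: a grouping is determined by the partition of the assignments that it induces. -/
theorem eq_of_sameKernel (C : CFLOBDD V k) {l : ℕ} :
    ∀ g h : C.Grouping l, C.SameKernel g h → g = h := by
  induction l with
  | zero =>
    intro g h H
    refine C.no_duplicates g h ?_
    have H0 := H (fun _ => false) (fun _ => true)
    simp only [MockCFLOBDD.run, Fin.ext_iff] at H0
    have := (C.branch g false).isLt
    have := (C.branch g true).isLt
    have := (C.branch h false).isLt
    have := (C.branch h true).isLt
    have hg := C.dontCare_or_fork g
    have hh := C.dontCare_or_fork h
    refine ⟨by omega, fun b => ?_⟩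
    cases b <;> omega
  | succ l ih => exact fun g h H => C.no_duplicates g h (C.sameProto_of_sameKernel_succ ih H)

/-! ### Realization of groupings at BDD nodes -/

/-- The grouping `g` induces the same partition of the assignments to its variables as the node
`u` of `B`, from which that many variables can be read. -/
def RealizedAt (C : CFLOBDD V k) {n l : ℕ} (g : C.Grouping l) (B : BDD V n)
    (u : Σ d, B.Node d) : Prop :=
  u.1 + 2 ^ l ≤ n ∧ ∀ a a', C.run g a = C.run g a' ↔
    B.walk u (List.ofFn a) = B.walk u (List.ofFn a')

theorem RealizedAt.eq {C : CFLOBDD V k} {n l : ℕ} {g h : C.Grouping l} {B : BDD V n}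
    {u : Σ d, B.Node d} (hg : C.RealizedAt g B u) (hh : C.RealizedAt h B u) : g = h :=
  C.eq_of_sameKernel g h fun a a' => (hg.2 a a').trans (hh.2 a a').symm

/-- Both the A-callee and the BDD identify two prefixes exactly when all continuations agree: the
former by `run_aCall_eq_iff`, the latter by maximal sharing (`eq_of_walk_eq`). -/
theorem RealizedAt.aCall {C : CFLOBDD V k} {n l : ℕ} {g : C.Grouping (l + 1)} {B : BDD V n}
    {u : Σ d, B.Node d} (hg : C.RealizedAt g B u) : C.RealizedAt (C.aCall g) B u := by
  obtain ⟨hn, hg⟩ := hg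
  rw [pow_succ] at hn
  refine ⟨by omega, fun a a' => ?_⟩
  rw [C.run_aCall_eq_iff C.eq_of_sameKernel]
  simp only [hg, ofFn_glue, B.walk_append]
  have hd : ∀ a : Fin (2 ^ l) → Bool, (B.walk u (List.ofFn a)).1 = u.1 + 2 ^ l := fun a => by
    rw [B.walk_fst _ _ (by rw [List.length_ofFn]; omega), List.length_ofFn]
  refine ⟨fun h => B.eq_of_walk_eq (2 ^ l) _ _ (by rw [hd, hd]) (by rw [hd]; omega) ?_,
    fun h b => by rw [h]⟩
  rintro L hL
  have := h fun i => L[i]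
  have hL' : List.ofFn (fun i : Fin (2 ^ l) => L[i]) = L :=
    List.ext_getElem (by simp [hL]) (by simp)
  rwa [hL'] at this

theorem RealizedAt.exists_bCall {C : CFLOBDD V k} {n l : ℕ} {g : C.Grouping (l + 1)}
    {B : BDD V n} {u : Σ d, B.Node d} (hg : C.RealizedAt g B u) (m : Fin (C.numMids g)) :
    ∃ v, C.RealizedAt (C.bCall g m) B v := by
  obtain ⟨hn, hg⟩ := hg
  rw [pow_succ] at hn
  obtain ⟨a, ha⟩ := C.exists_run_eq_mid g m
  -- Any prefix `a` leading to `m` gives a suitable node.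
  refine ⟨B.walk u (List.ofFn a), ?_, fun b b' => ?_⟩
  · rw [B.walk_fst _ _ (by rw [List.length_ofFn]; omega), List.length_ofFn]; omega
  · rw [← (C.b_injective g m).eq_iff, ← C.run_glue_of_mid g a b m ha,
      ← C.run_glue_of_mid g a b' m ha, hg, ofFn_glue, ofFn_glue, B.walk_append, B.walk_append]

theorem realizedAt_head {f : (Fin (2 ^ k) → Bool) → V} {ord : Equiv.Perm (Fin (2 ^ k))}
    {B : BDD V (2 ^ k)} {C : CFLOBDD V k} (hB : B.Represents ord f) (hC : C.Represents ord f) :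
    C.RealizedAt C.head B ⟨0, B.root⟩ := by
  have key : ∀ a, C.eval a = B.eval a := fun a => by
    have h1 := hB (a ∘ ord.symm)
    have h2 := hC (a ∘ ord.symm)
    simp only [Function.comp_apply, Equiv.symm_apply_apply] at h1 h2
    rw [h1, h2]
  refine ⟨by simp, fun a a' => ?_⟩
  rw [B.walk_root_eq_iff, ← key, ← key]
  exact C.value_injective.eq_iff.symm

theorem exists_realizedAt {f : (Fin (2 ^ k) → Bool) → V} {ord : Equiv.Perm (Fin (2 ^ k))}
    {B : BDD V (2 ^ k)} {C : CFLOBDD V k} (hB : B.Represents ord f) (hC : C.Represents ord f)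
    {l : ℕ} (g : C.Grouping l) : ∃ u, C.RealizedAt g B u := by
  have hl : l ≤ k := by
    by_contra h
    exact (C.no_grouping_above l (by omega)).false g
  induction hl using Nat.decreasingInduction with
  | self =>
    rw [C.head_unique g]
    exact ⟨_, realizedAt_head hB hC⟩
  | of_succ l hl ih =>
    obtain ⟨h, rfl | ⟨m, rfl⟩⟩ := C.called hl g
    · exact (ih h).imp fun u hu => hu.aCall
    · obtain ⟨u, hu⟩ := ih h
      exact hu.exists_bCall m

theorem numGroupings_le {f : (Fin (2 ^ k) → Bool) → V} {ord : Equiv.Perm (Fin (2 ^ k))}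
    {B : BDD V (2 ^ k)} {C : CFLOBDD V k} (hB : B.Represents ord f) (hC : C.Represents ord f) :
    C.numGroupings ≤ (k + 1) * Nat.card {u : Σ d, B.Node d // u.1 < 2 ^ k} := by
  have := B.finite_nodes
  choose node hnode using fun g : Σ l, C.Grouping l => exists_realizedAt hB hC g.2
  have hl : ∀ g : Σ l, C.Grouping l, g.1 < k + 1 := fun g => by
    by_contra h
    exact (C.no_grouping_above g.1 (by omega)).false g.2
  -- At least one variable is still to be read at the node, so it is non-terminal.
  have hd : ∀ g, (node g).1 < 2 ^ k := fun g => by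
    have := (hnode g).1
    have := Nat.two_pow_pos g.1
    omega
  have := Nat.card_le_card_of_injective
    (fun g => ((⟨g.1, hl g⟩, ⟨node g, hd g⟩) :
      Fin (k + 1) × {u : Σ d, B.Node d // u.1 < 2 ^ k})) (by
    rintro ⟨l, g⟩ ⟨l', h⟩ e
    simp only [Prod.mk.injEq, Fin.mk.injEq, Subtype.mk.injEq] at e
    obtain ⟨rfl, e⟩ := e
    have h1 := hnode ⟨l, g⟩
    rw [e] at h1
    exact congrArg _ (h1.eq (hnode ⟨l, h⟩)))
  simpa [Nat.card_prod, MockCFLOBDD.numGroupings] using this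

end CFLOBDD

/-! ### The size estimate -/

theorem mainTheorem4 :
    ∃ K : ℝ, 0 < K ∧
      ∀ (V : Type u) (k : ℕ) (f : (Fin (2 ^ k) → Bool) → V) (ord : Equiv.Perm (Fin (2 ^ k)))
        (B : BDD V (2 ^ k)) (C : CFLOBDD V k),
        B.Represents ord f → C.Represents ord f →
          (C.numGroupings : ℝ) ≤ K * (B.numNodes * Real.log B.numNodes) ∧
          (C.numGroupings : ℝ) ≤ K * (B.numEdges * Real.log B.numEdges) := by
  -- The `2` comes from `2 * M ≤ N ^ 2` in the node bound; dividing by `Real.log 2` converts to base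
  -- 2.
  refine ⟨2 / Real.log 2, by positivity, fun V k f ord B C hB hC => ?_⟩
  have hlog : 0 < Real.log 2 := Real.log_pos one_lt_two
  have hG := CFLOBDD.numGroupings_le hB hC
  have hM := B.le_card_nonterminal
  have hN := B.card_nonterminal_lt_numNodes
  rw [B.numEdges_eq]
  generalize Nat.card {u : Σ d, B.Node d // u.1 < 2 ^ k} = M at *
  have hM1 : 1 ≤ M := Nat.one_le_two_pow.trans hM
  have hGR : (C.numGroupings : ℝ) ≤ (k + 1) * M := by exact_mod_cast hG
  have hMR : (2 : ℝ) ^ k ≤ M := by exact_mod_cast hM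
  have hM1R : (1 : ℝ) ≤ M := by exact_mod_cast hM1
  have hNR : (M : ℝ) + 1 ≤ B.numNodes := by exact_mod_cast hN
  have hk : (k + 1) * Real.log 2 ≤ Real.log (M * 2) := by
    have h := Real.log_le_log (by positivity) (by linarith : (2 : ℝ) ^ k * 2 ≤ M * 2)
    rw [← pow_succ, Real.log_pow] at h
    exact_mod_cast h
  -- With `N` nodes, at least one of them terminal, `2 * M ≤ (M + 1) ^ 2 ≤ N ^ 2`.
  have hk' : (k + 1) * Real.log 2 ≤ 2 * Real.log B.numNodes := by
    refine hk.trans ?_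
    have h := Real.log_le_log (by positivity)
      (by nlinarith : (M : ℝ) * 2 ≤ (B.numNodes : ℝ) ^ 2)
    rw [Real.log_pow] at h
    exact_mod_cast h
  have hlogM : 0 ≤ Real.log (M * 2) := Real.log_nonneg (by linarith)
  have hlogN : 0 ≤ Real.log B.numNodes := Real.log_nonneg (by linarith)
  push_cast
  rw [div_mul_eq_mul_div, le_div_iff₀ hlog, div_mul_eq_mul_div, le_div_iff₀ hlog]
  have h1 := mul_le_mul_of_nonneg_right hGR hlog.le
  constructor
  · have h2 := mul_le_mul_of_nonneg_right hk' (by linarith : (0 : ℝ) ≤ M)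
    have h3 := mul_le_mul_of_nonneg_right (by linarith : (M : ℝ) ≤ B.numNodes) hlogN
    linarith
  · have h2 := mul_le_mul_of_nonneg_right hk (by linarith : (0 : ℝ) ≤ M)
    have h3 := mul_nonneg (by linarith : (0 : ℝ) ≤ M) hlogM
    linarith
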